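/- Let $N\ge 1$, let $\Delta_N=\{x\in\mathbb R^N: x_i\ge 0,\ \sum_i x_i=1\}$, let $\eta>0$, $L>0$, $u_{\max}\in\mathbb R$, and let $T$ be a number of periods. Let $F$ be a probability distribution on $\mathbb R^N$ (the common law of the shock vectors) and put $$\varphi_\eta(\theta)=\mathbb E_{\epsilon\sim F}\Big[\max_{1\le i\le N}(\theta_i+\eta\epsilon_i)\Big],\qquad \varphi=\varphi_1,$$ so that $\varphi_\eta(\theta)=\eta\varphi(\theta/\eta)$ and $\varphi(0)=\mathbb E_{\epsilon\sim F}[\max_i\epsilon_i]$. Assumption 1: $F$ has zero mean, is absolutely continuous with respect to Lebesgue measure and has full support $\mathbb R^N$. Assumption 2: the Hessian of $\varphi_\eta$ exists everywhere (that is, the derivative of $\varphi_\eta$ is differentiable) and $2\,\mathrm{Tr}(\nabla^2\varphi_\eta(\theta))\le L/\eta$ for all $\theta\in\mathbb R^N$. Let $\mathcal R(x)=\sup_{\theta\in\mathbb R^N}\{\langle\theta,x\rangle-\varphi_\eta(\theta)\}$ be the convex conjugate of the social surplus function $\varphi_\eta$. For payoff vectors $u_1,\dots,u_T\in\mathbb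 R^N$ let $\theta_0=0$ and $\theta_t=\sum_{s=1}^t u_s$. The Follow the Regularized Leader (FTRL) algorithm chooses $$x_{t+1}=\arg\max_{x\in\Delta_N}\{\langle\theta_t,x\rangle-\mathcal R(x)\},\qquad t=0,\dots,T-1,$$ and its regret is $\mathrm R^T_{FTRL}=\max_{x\in\Delta_N}\langle\theta_T,x\rangle-\sum_{t=1}^T\langle u_t,x_t\rangle$. Theorem. Under Assumptions 1 and 2, for every $\theta\in\mathbb R^N$ the problem $\max_{x\in\Delta_N}\{\langle\theta,x\rangle-\mathcal R(x)\}$ has exactly one solution, so the FTRL algorithm is well defined; and for all payoff vectors $u_1,\dots,u_T$ with $\|u_t\|_\infty\le u_{\max}$ for every $t$, $$\mathrm R^T_{FTRL}\le \eta\,\varphi(0)+\frac{L}{2\eta}\,T\,u_{\max}^2 .$$ Moreover, if $\eta=\sqrt{\dfrac{L\,T\,u_{\max}^2}{2\varphi(0)}}$, then $$\mathrm R^T_{FTRL}\le u_{\max}\sqrt{2\,\varphi(0)\,L\,T}.$$ -/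

import Mathlib

namespace RUM

open MeasureTheory

/-- The social surplus function with learning parameter `η`:
`φ_η(θ) = E_{ε ∼ F} [max_i (θ_i + η ε_i)]`.  For `η = 1` this is the unscaled social surplus, and
`φ_η(θ) = η φ_1(θ / η)` when `0 < η`. -/
noncomputable def socialSurplus {N : ℕ} [NeZero N] (F : Measure (Fin N → ℝ)) (η : ℝ)
    (θ : Fin N → ℝ) : ℝ :=
  ∫ ε, Finset.univ.sup' Finset.univ_nonempty (fun i => θ i + η * ε i) ∂F

/-- The assumption on the common law `F` of the shock vectors: a probability distribution on `ℝ^N`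
with (existing and) zero mean, absolutely continuous with respect to Lebesgue measure, and with
full support. -/
structure ShocksAssumption {N : ℕ} (F : Measure (Fin N → ℝ)) : Prop where
  isProbability : IsProbabilityMeasure F
  integrable : ∀ i, Integrable (fun ε : Fin N → ℝ => ε i) F
  zeroMean : ∀ i, ∫ ε, ε i ∂F = 0
  absolutelyContinuous : F ≪ volume
  fullSupport : F.support = Set.univ

/-- The Hessian matrix `(∂_i ∂_j f)(θ)`. -/
noncomputable def hessian {N : ℕ} (f : (Fin N → ℝ) → ℝ) (θ : Fin N → ℝ) :
    Matrix (Fin N) (Fin N) ℝ :=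
  Matrix.of fun i j =>
    fderiv ℝ (fun θ' => fderiv ℝ f θ' (Pi.single j 1)) θ (Pi.single i 1)

/-- The assumption on the Hessian of the social surplus: it exists everywhere (the derivative of
`φ_η` is differentiable) and `2 Tr(∇²φ_η(θ)) ≤ L / η` for every `θ`, where `L > 0`. -/
structure HessianAssumption {N : ℕ} [NeZero N] (F : Measure (Fin N → ℝ)) (η L : ℝ) : Prop where
  pos : 0 < L
  differentiable_fderiv : Differentiable ℝ (fderiv ℝ (socialSurplus F η))
  trace_le : ∀ θ : Fin N → ℝ, 2 * (hessian (socialSurplus F η) θ).trace ≤ L / η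

/-- The convex conjugate `f*(x) = sup_θ (⟨θ, x⟩ - f(θ))`, with values in `[-∞, ∞]`. -/
noncomputable def convexConjugate {N : ℕ} (f : (Fin N → ℝ) → ℝ) (x : Fin N → ℝ) : EReal :=
  ⨆ θ : Fin N → ℝ, ((θ ⬝ᵥ x - f θ : ℝ) : EReal)

/-- The regularizer `R`, the convex conjugate of the social surplus `φ_η`
(equivalently `R = η φ_1*`, since `φ_η(θ) = η φ_1(θ / η)`). -/
noncomputable def regularizer {N : ℕ} [NeZero N] (F : Measure (Fin N → ℝ)) (η : ℝ)
    (x : Fin N → ℝ) : EReal :=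
  convexConjugate (socialSurplus F η) x

/-- `x ∈ argmax_{y ∈ Δ_N} (⟨θ, y⟩ - R(y))`. -/
def IsRegularizedLeader {N : ℕ} [NeZero N] (F : Measure (Fin N → ℝ)) (η : ℝ)
    (θ x : Fin N → ℝ) : Prop :=
  x ∈ stdSimplex ℝ (Fin N) ∧
    IsMaxOn (fun y => ((θ ⬝ᵥ y : ℝ) : EReal) - regularizer F η y) (stdSimplex ℝ (Fin N)) x

/-- The cumulative payoff vector `θ_t = u_1 + ⋯ + u_t` (so `θ_0 = 0`). -/
def cumulativePayoff {N : ℕ} (u : ℕ → Fin N → ℝ) (t : ℕ) : Fin N → ℝ :=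
  ∑ s ∈ Finset.Icc 1 t, u s

/-- `x_1, …, x_T` are the choices of Follow the Regularized Leader on the payoffs `u_1, …, u_T`:
`x_1 = argmax_{y ∈ Δ_N} (-R(y))` and `x_{t+1} = argmax_{y ∈ Δ_N} (⟨θ_t, y⟩ - R(y))`. -/
def IsFTRL {N : ℕ} [NeZero N] (F : Measure (Fin N → ℝ)) (η : ℝ) (T : ℕ)
    (u x : ℕ → Fin N → ℝ) : Prop :=
  ∀ t < T, IsRegularizedLeader F η (cumulativePayoff u t) (x (t + 1))

/-- The regret `max_{y ∈ Δ_N} ⟨θ_T, y⟩ - ∑_{t=1}^T ⟨u_t, x_t⟩`. The supremum is a maximum because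
the simplex is compact and nonempty. -/
noncomputable def regret {N : ℕ} (T : ℕ) (u x : ℕ → Fin N → ℝ) : ℝ :=
  sSup ((fun y => cumulativePayoff u T ⬝ᵥ y) '' stdSimplex ℝ (Fin N)) -
    ∑ t ∈ Finset.Icc 1 T, u t ⬝ᵥ x t

end RUM

namespace RUM

open MeasureTheory Filter Topology

/-! The surplus `φ_η` serves as a potential. By Fenchel duality the leader at `θ` is the gradient of
`φ_η` at `θ` (`isRegularizedLeader_iff`), so in the Taylor expansion of `φ_η` from `θ_t` to
`θ_{t+1}` the linear term is exactly the payoff `⟨u_{t+1}, x_{t+1}⟩`. If each remainder is at most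
`L umax² / (2η)`, the steps telescope from `φ_η(0) = η φ(0)`, and zero-mean shocks give `max_i θ_i ≤
φ_η(θ)`, which bounds the regret.

The remainder bound comes from the order structure of the maximum, which averaging over shocks
preserves. Commuting with the addition of constants makes the Hessian rows sum to zero;
submodularity makes the off-diagonal entries nonpositive. Hence the absolute values of all entries
add up to twice the trace, which controls the quadratic form in the sup norm
(`IsSurplus.fderiv_fderiv_apply_le`). -/

/-- The largest coordinate of a vector. -/
noncomputable def maxCoord {N : ℕ} [NeZero N] (x : Fin N → ℝ) : ℝ :=
  Finset.univ.sup' Finset.univ_nonempty x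

/-! ### Order properties of the maximum -/

section maxCoord

variable {N : ℕ} [NeZero N]

theorem le_maxCoord (x : Fin N → ℝ) (i : Fin N) : x i ≤ maxCoord x :=
  Finset.le_sup' x (Finset.mem_univ i)

theorem maxCoord_le {x : Fin N → ℝ} {c : ℝ} (h : ∀ i, x i ≤ c) : maxCoord x ≤ c :=
  Finset.sup'_le _ _ fun i _ => h i

theorem maxCoord_mono : Monotone (maxCoord : (Fin N → ℝ) → ℝ) := fun _ y h =>
  maxCoord_le fun i => (h i).trans (le_maxCoord y i)

theorem maxCoord_add_const (x : Fin N → ℝ) (c : ℝ) :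
    maxCoord (x + fun _ => c) = maxCoord x + c := by
  apply le_antisymm
  · exact maxCoord_le fun i => add_le_add (le_maxCoord x i) le_rfl
  · rw [← le_sub_iff_add_le]
    exact maxCoord_le fun i => le_sub_iff_add_le.2 (le_maxCoord (x + fun _ => c) i)

theorem maxCoord_smul {η : ℝ} (hη : 0 ≤ η) (x : Fin N → ℝ) :
    maxCoord (η • x) = η * maxCoord x := by
  apply le_antisymm
  · exact maxCoord_le fun i => mul_le_mul_of_nonneg_left (le_maxCoord x i) hη
  · obtain ⟨i, -, hi⟩ := Finset.exists_mem_eq_sup' Finset.univ_nonempty x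
    rw [maxCoord, hi]
    exact le_maxCoord (η • x) i

theorem maxCoord_add_le (x y : Fin N → ℝ) : maxCoord (x + y) ≤ maxCoord x + maxCoord y :=
  maxCoord_le fun i => add_le_add (le_maxCoord x i) (le_maxCoord y i)

/-- The join is bounded by the larger of the two maxima and the meet by the smaller. -/
theorem maxCoord_submodular (x y : Fin N → ℝ) :
    maxCoord (x ⊔ y) + maxCoord (x ⊓ y) ≤ maxCoord x + maxCoord y := by
  have hs : maxCoord (x ⊔ y) ≤ max (maxCoord x) (maxCoord y) :=
    maxCoord_le fun i => max_le_max (le_maxCoord x i) (le_maxCoord y i)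
  have hi : maxCoord (x ⊓ y) ≤ min (maxCoord x) (maxCoord y) :=
    le_min (maxCoord_mono inf_le_left) (maxCoord_mono inf_le_right)
  linarith [max_add_min (maxCoord x) (maxCoord y)]

end maxCoord

/-- The order and convexity properties that `maxCoord` shares with every average of its
translates. -/
structure IsSurplus {N : ℕ} (f : (Fin N → ℝ) → ℝ) : Prop where
  mono : Monotone f
  add_const : ∀ x c, f (x + fun _ => c) = f x + c
  convexOn : ConvexOn ℝ Set.univ f
  submodular : ∀ x y, f (x ⊔ y) + f (x ⊓ y) ≤ f x + f y

/-! ### Averaging over the shocks -/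

section socialSurplus

variable {N : ℕ} [NeZero N] {F : Measure (Fin N → ℝ)}

theorem socialSurplus_eq_integral (F : Measure (Fin N → ℝ)) (η : ℝ) (θ : Fin N → ℝ) :
    socialSurplus F η θ = ∫ ε, maxCoord (θ + η • ε) ∂F := rfl

theorem ShocksAssumption.integrable_maxCoord (hF : ShocksAssumption F) (η : ℝ)
    (θ : Fin N → ℝ) : Integrable (fun ε => maxCoord (θ + η • ε)) F := by
  have := hF.isProbability
  have h : Integrable (Finset.univ.sup' Finset.univ_nonempty
      fun (i : Fin N) (ε : Fin N → ℝ) => θ i + η * ε i) F :=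
    Finset.sup'_induction (p := fun g => Integrable g F) _ _
      (fun _ h₁ _ h₂ => h₁.sup h₂)
      fun i _ => (integrable_const _).add ((hF.integrable i).const_mul η)
  refine h.congr (ae_of_all _ fun ε => ?_)
  rw [Finset.sup'_apply]
  rfl

theorem ShocksAssumption.isSurplus (hF : ShocksAssumption F) (η : ℝ) :
    IsSurplus (socialSurplus F η) := by
  have := hF.isProbability
  have hint := hF.integrable_maxCoord η
  refine ⟨fun x y h => ?_, fun x c => ?_, ⟨convex_univ, fun x _ y _ a b ha hb hab => ?_⟩,
    fun x y => ?_⟩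
  · exact integral_mono (hint x) (hint y) fun ε => maxCoord_mono (add_le_add h le_rfl)
  · simp only [socialSurplus_eq_integral]
    have : ∀ ε : Fin N → ℝ, maxCoord ((x + fun _ => c) + η • ε) = maxCoord (x + η • ε) + c :=
      fun ε => by rw [← maxCoord_add_const, add_right_comm]
    simp only [this]
    rw [integral_add (hint x) (integrable_const c)]
    simp
  · simp only [socialSurplus_eq_integral, smul_eq_mul]
    rw [← integral_const_mul, ← integral_const_mul,
      ← integral_add ((hint x).const_mul a) ((hint y).const_mul b)]
    refine integral_mono (hint _) (((hint x).const_mul a).add ((hint y).const_mul b)) fun ε => ?_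
    have : a • x + b • y + η • ε = a • (x + η • ε) + b • (y + η • ε) := by
      rw [smul_add, smul_add, add_add_add_comm, ← add_smul, hab, one_smul]
    simp only [this]
    refine (maxCoord_add_le _ _).trans_eq ?_
    rw [maxCoord_smul ha, maxCoord_smul hb]
  · simp only [socialSurplus_eq_integral]
    rw [← integral_add (hint _) (hint _), ← integral_add (hint _) (hint _)]
    refine integral_mono ((hint _).add (hint _)) ((hint _).add (hint _)) fun ε => ?_
    simp only [sup_add, inf_add]
    exact maxCoord_submodular _ _

/-- The maximum dominates coordinate `i`, whose shock averages to zero. -/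
theorem ShocksAssumption.apply_le_socialSurplus (hF : ShocksAssumption F) (η : ℝ)
    (θ : Fin N → ℝ) (i : Fin N) : θ i ≤ socialSurplus F η θ := by
  have := hF.isProbability
  have hi := (hF.integrable i).const_mul η
  have h : ∫ ε, (θ i + η * ε i) ∂F = θ i := by
    rw [integral_add (integrable_const _) hi, integral_const_mul, hF.zeroMean]
    simp
  rw [← h]
  exact integral_mono ((integrable_const _).add hi) (hF.integrable_maxCoord η θ)
    fun ε => le_maxCoord (θ + η • ε) i

theorem socialSurplus_zero {η : ℝ} (hη : 0 ≤ η) :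
    socialSurplus F η 0 = η * socialSurplus F 1 0 := by
  simp only [socialSurplus_eq_integral, zero_add, one_smul, maxCoord_smul hη]
  exact integral_const_mul _ _

end socialSurplus

/-! ### Calculus along lines -/

/-- The gradient of `f` as a vector. -/
noncomputable def gradientVector {N : ℕ} (f : (Fin N → ℝ) → ℝ) (θ : Fin N → ℝ) : Fin N → ℝ :=
  fun i => fderiv ℝ f θ (Pi.single i 1)

theorem map_eq_sum_single {N : ℕ} {M : Type*} [AddCommMonoid M] [Module ℝ M] [TopologicalSpace M]
    (A : (Fin N → ℝ) →L[ℝ] M) (v : Fin N → ℝ) :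
    A v = ∑ i, v i • A (Pi.single i 1) := by
  conv_lhs => rw [pi_eq_sum_univ' v]
  simp only [map_sum, map_smul]

theorem fderiv_apply_eq_dotProduct {N : ℕ} (f : (Fin N → ℝ) → ℝ) (θ v : Fin N → ℝ) :
    fderiv ℝ f θ v = v ⬝ᵥ gradientVector f θ :=
  map_eq_sum_single _ _

theorem hasDerivAt_comp_line {E G : Type*} [NormedAddCommGroup E] [NormedSpace ℝ E]
    [NormedAddCommGroup G] [NormedSpace ℝ G] {f : E → G} (hf : Differentiable ℝ f) (θ v : E)
    (s : ℝ) : HasDerivAt (fun s : ℝ => f (θ + s • v)) (fderiv ℝ f (θ + s • v) v) s := by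
  have h : HasDerivAt (fun s : ℝ => θ + s • v) v s := by
    simpa using ((hasDerivAt_id s).smul_const v).const_add θ
  exact (hf _).hasFDerivAt.comp_hasDerivAt s h

theorem hasDerivAt_fderiv_line {E : Type*} [NormedAddCommGroup E] [NormedSpace ℝ E] {f : E → ℝ}
    (hf' : Differentiable ℝ (fderiv ℝ f)) (θ v w : E) (s : ℝ) :
    HasDerivAt (fun s : ℝ => fderiv ℝ f (θ + s • v) w)
      (fderiv ℝ (fderiv ℝ f) (θ + s • v) v w) s :=
  (ContinuousLinearMap.apply ℝ ℝ w).hasFDerivAt.comp_hasDerivAt s (hasDerivAt_comp_line hf' θ v s)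

/-- Second-order Taylor upper bound along a segment. -/
theorem le_add_fderiv_add_of_second_deriv_le {E : Type*} [NormedAddCommGroup E] [NormedSpace ℝ E]
    {f : E → ℝ} (hf : Differentiable ℝ f) (hf' : Differentiable ℝ (fderiv ℝ f)) {θ v : E} {C : ℝ}
    (hC : ∀ x, fderiv ℝ (fderiv ℝ f) x v v ≤ C) :
    f (θ + v) ≤ f θ + fderiv ℝ f θ v + C / 2 := by
  set g' : ℝ → ℝ := fun s => fderiv ℝ f (θ + s • v) v
  have hg' : ∀ s, HasDerivAt g' (fderiv ℝ (fderiv ℝ f) (θ + s • v) v v) s := fun s =>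
    hasDerivAt_fderiv_line hf' θ v v s
  have hk : ∀ s, HasDerivAt (fun s => C * s - g' s)
      (C - fderiv ℝ (fderiv ℝ f) (θ + s • v) v v) s := fun s => by
    simpa only [mul_one] using! ((hasDerivAt_id s).const_mul C).sub (hg' s)
  -- This yields `g' s ≤ g' 0 + C * s` for `s ≥ 0` without integrating the second derivative, which
  -- need not be continuous.
  have hkm : Monotone fun s => C * s - g' s :=
    monotone_of_deriv_nonneg (fun s => (hk s).differentiableAt) fun s => by
      rw [(hk s).deriv]
      linarith [hC (θ + s • v)]
  have hh : ∀ s, HasDerivAt (fun s => g' 0 * s + C / 2 * s ^ 2 - f (θ + s • v))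
      (g' 0 + C * s - g' s) s := fun s => by
    have h₁ := (hasDerivAt_id s).const_mul (g' 0)
    have h₂ := ((hasDerivAt_id s).pow 2).const_mul (C / 2)
    have h := (h₁.add h₂).sub (hasDerivAt_comp_line hf θ v s)
    refine h.congr_deriv ?_
    simp only [id, mul_one, g']
    norm_num
    ring
  have hm : MonotoneOn (fun s => g' 0 * s + C / 2 * s ^ 2 - f (θ + s • v)) (Set.Ici 0) := by
    refine monotoneOn_of_deriv_nonneg (convex_Ici 0)
      (fun s _ => (hh s).continuousAt.continuousWithinAt)
      (fun s _ => (hh s).differentiableAt.differentiableWithinAt) fun s hs => ?_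
    rw [(hh s).deriv]
    rw [interior_Ici] at hs
    have := hkm (le_of_lt hs)
    simp only [mul_zero] at this
    linarith
  have := hm (Set.mem_Ici.2 le_rfl) (Set.mem_Ici.2 zero_le_one) zero_le_one
  simp [g'] at this
  linarith

/-- A differentiable convex function lies above its tangent planes. -/
theorem add_fderiv_le_of_convexOn {E : Type*} [NormedAddCommGroup E] [NormedSpace ℝ E]
    {f : E → ℝ} (hc : ConvexOn ℝ Set.univ f) (hf : Differentiable ℝ f) (θ v : E) :
    f θ + fderiv ℝ f θ v ≤ f (θ + v) := by
  have hg : ConvexOn ℝ Set.univ fun s : ℝ => f (θ + s • v) := by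
    have := hc.comp_affineMap (AffineMap.lineMap θ (θ + v))
    simpa [Function.comp_def, AffineMap.lineMap_apply, add_comm] using this
  have := hg.le_slope_of_hasDerivAt (Set.mem_univ 0) (Set.mem_univ 1) zero_lt_one
    (hasDerivAt_comp_line hf θ v 0)
  simp [slope_def_field] at this
  linarith

/-! ### First-order properties of surplus functions -/

namespace IsSurplus

variable {N : ℕ} {f : (Fin N → ℝ) → ℝ}

/-- Coordinatewise `x ≤ y + dist x y` in the sup metric; monotonicity and `add_const` transfer this
to `f`. -/
theorem lipschitzWith (hf : IsSurplus f) : LipschitzWith 1 f := by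
  refine LipschitzWith.of_le_add fun x y => ?_
  rw [← hf.add_const]
  refine hf.mono fun i => ?_
  have := (le_abs_self _).trans ((norm_le_pi_norm (x - y) i).trans_eq (dist_eq_norm x y).symm)
  simp only [Pi.sub_apply] at this
  simp only [Pi.add_apply]
  linarith

theorem fderiv_apply_one (hf : IsSurplus f) {θ : Fin N → ℝ} (hd : DifferentiableAt ℝ f θ) :
    fderiv ℝ f θ (fun _ => 1) = 1 := by
  have h : HasDerivAt (fun s : ℝ => θ + s • fun _ : Fin N => (1 : ℝ)) (fun _ => 1) 0 := by
    simpa using ((hasDerivAt_id (0 : ℝ)).smul_const (fun _ : Fin N => (1 : ℝ))).const_add θ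
  have h₁ : HasDerivAt (fun s : ℝ => f (θ + s • fun _ => 1)) (fderiv ℝ f θ fun _ => 1) 0 :=
    HasFDerivAt.comp_hasDerivAt 0 (by simpa using hd.hasFDerivAt) h
  have h₂ : HasDerivAt (fun s : ℝ => f (θ + s • fun _ => 1)) 1 0 := by
    have : (fun s : ℝ => f (θ + s • fun _ => 1)) = fun s => f θ + s := by
      ext s
      rw [← hf.add_const]
      congr 2
      ext i
      simp
    rw [this]
    exact (hasDerivAt_id 0).const_add _
  exact h₁.unique h₂

/-- By Rademacher's theorem, a surplus function with continuous `fderiv` is differentiable: at a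
point of nondifferentiability `fderiv` vanishes, but it maps the all-ones vector to `1` at almost
every point. -/
theorem differentiable (hf : IsSurplus f) (hc : Continuous (fderiv ℝ f)) :
    Differentiable ℝ f := by
  intro θ
  by_contra hθ
  have hopen : IsOpen {x | fderiv ℝ f x (fun _ => 1) < 1} :=
    isOpen_lt (hc.clm_apply continuous_const) continuous_const
  have hne : {x | fderiv ℝ f x (fun _ => 1) < 1}.Nonempty :=
    ⟨θ, by simp [fderiv_zero_of_not_differentiableAt hθ]⟩
  have hae : ∀ᵐ x, DifferentiableAt ℝ f x := hf.lipschitzWith.ae_differentiableAt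
  obtain ⟨x, hx, hxd⟩ := (Measure.dense_of_ae hae).inter_open_nonempty _ hopen hne
  exact hx.ne (hf.fderiv_apply_one hxd)

theorem gradientVector_mem_stdSimplex (hf : IsSurplus f) (hd : Differentiable ℝ f)
    (θ : Fin N → ℝ) : gradientVector f θ ∈ stdSimplex ℝ (Fin N) := by
  refine ⟨fun i => ?_, ?_⟩
  · have hm : Monotone fun s : ℝ => f (θ + s • Pi.single i (1 : ℝ)) := fun s t h =>
      hf.mono <| add_le_add le_rfl <|
        smul_le_smul_of_nonneg_right h (Pi.single_nonneg.2 zero_le_one)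
    have h := hasDerivAt_comp_line hd θ (Pi.single i (1 : ℝ)) 0
    have := hm.deriv_nonneg (x := 0)
    rw [h.deriv] at this
    simpa [gradientVector] using this
  · have := fderiv_apply_eq_dotProduct f θ (fun _ => 1)
    rw [hf.fderiv_apply_one (hd θ)] at this
    simpa [dotProduct] using this.symm

/-- Partial derivatives decrease along the other coordinate directions. -/
theorem gradientVector_add_single_le (hf : IsSurplus f) (hd : Differentiable ℝ f)
    (θ : Fin N → ℝ) {i j : Fin N} (hij : i ≠ j) {b : ℝ} (hb : 0 ≤ b) :
    gradientVector f (θ + b • Pi.single i 1) j ≤ gradientVector f θ j := by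
  have h₁ := hasDerivAt_comp_line hd (θ + b • Pi.single i 1) (Pi.single j (1 : ℝ)) 0
  have h₀ := hasDerivAt_comp_line hd θ (Pi.single j (1 : ℝ)) 0
  simp only [zero_smul, add_zero] at h₁ h₀
  refine le_of_tendsto_of_tendsto h₁.tendsto_slope_zero_right
    h₀.tendsto_slope_zero_right ?_
  filter_upwards [self_mem_nhdsWithin] with a ha
  have ha : 0 < a := ha
  refine mul_le_mul_of_nonneg_left ?_ (inv_nonneg.2 ha.le)
  -- The join adds both increments to `θ` and the meet is `θ`, so submodularity compares the two
  -- difference quotients.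
  have key := hf.submodular (θ + b • Pi.single i 1) (θ + a • Pi.single j 1)
  have hs : (θ + b • Pi.single i 1) ⊔ (θ + a • Pi.single j 1)
      = θ + b • Pi.single i 1 + a • Pi.single j (1 : ℝ) := by
    ext k
    by_cases hi : k = i
    · subst hi
      simp [hij, hb]
    · by_cases hj : k = j
      · subst hj
        simp [hi, ha.le]
      · simp [hi, hj]
  have hi : (θ + b • Pi.single i 1) ⊓ (θ + a • Pi.single j (1 : ℝ)) = θ := by
    ext k
    by_cases hi : k = i
    · subst hi
      simp [hij, hb]
    · by_cases hj : k = j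
      · subst hj
        simp [hi, ha.le]
      · simp [hi, hj]
  rw [hs, hi] at key
  simp only [zero_add, zero_smul, add_zero]
  linarith

end IsSurplus

/-! ### Sign structure of the Hessian -/

section hessian

variable {N : ℕ} {f : (Fin N → ℝ) → ℝ}

theorem hessian_apply (hf' : Differentiable ℝ (fderiv ℝ f)) (θ : Fin N → ℝ) (i j : Fin N) :
    hessian f θ i j = fderiv ℝ (fderiv ℝ f) θ (Pi.single i 1) (Pi.single j 1) := by
  rw [hessian, Matrix.of_apply,
    ((hf' θ).hasFDerivAt.clm_apply (hasFDerivAt_const _ θ)).fderiv]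
  simp

theorem fderiv_fderiv_apply_eq_sum (hf' : Differentiable ℝ (fderiv ℝ f)) (θ v w : Fin N → ℝ) :
    fderiv ℝ (fderiv ℝ f) θ v w = ∑ i, ∑ j, v i * (w j * hessian f θ i j) := by
  rw [map_eq_sum_single (fderiv ℝ (fderiv ℝ f) θ) v, sum_apply]
  refine Finset.sum_congr rfl fun i _ => ?_
  rw [smul_apply, map_eq_sum_single _ w, Finset.smul_sum]
  simp [hessian_apply hf']

/-- The derivative along the all-ones vector is constantly `1`; differentiate it once more. -/
theorem IsSurplus.sum_hessian (hf : IsSurplus f) (hf' : Differentiable ℝ (fderiv ℝ f))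
    (θ : Fin N → ℝ) (i : Fin N) : ∑ j, hessian f θ i j = 0 := by
  have hd := hf.differentiable hf'.continuous
  have h := fderiv_fderiv_apply_eq_sum hf' θ (Pi.single i 1) fun _ => 1
  have h₀ : HasFDerivAt (fun x => fderiv ℝ f x fun _ => 1) (0 : (Fin N → ℝ) →L[ℝ] ℝ) θ := by
    simp only [hf.fderiv_apply_one (hd _)]
    exact hasFDerivAt_const _ _
  have h₁ := ((hf' θ).hasFDerivAt.clm_apply
    (hasFDerivAt_const (fun _ : Fin N => (1 : ℝ)) θ)).unique h₀
  have h₂ := DFunLike.congr_fun h₁ (Pi.single i 1)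
  simp at h₂
  rw [h₂, Finset.sum_eq_single i] at h
  · simpa using h.symm
  · intro k _ hk
    simp [hk]
  · simp

theorem IsSurplus.hessian_nonpos (hf : IsSurplus f) (hf' : Differentiable ℝ (fderiv ℝ f))
    (θ : Fin N → ℝ) {i j : Fin N} (hij : i ≠ j) : hessian f θ i j ≤ 0 := by
  have hd := hf.differentiable hf'.continuous
  have hg : HasDerivAt (fun s : ℝ => gradientVector f (θ + s • Pi.single i 1) j)
      (hessian f θ i j) 0 := by
    have := hasDerivAt_fderiv_line hf' θ (Pi.single i 1) (Pi.single j (1 : ℝ)) 0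
    simpa [hessian_apply hf', gradientVector] using this
  have ha : Antitone fun s : ℝ => gradientVector f (θ + s • Pi.single i 1) j := fun s t hst => by
    have := hf.gradientVector_add_single_le hd (θ + s • Pi.single i 1) hij (sub_nonneg.2 hst)
    rwa [add_assoc, ← add_smul, add_sub_cancel] at this
  rw [← hg.deriv]
  exact ha.deriv_nonpos

/-- The second derivative of a surplus function is controlled by twice the trace of its Hessian. -/
theorem IsSurplus.fderiv_fderiv_apply_le (hf : IsSurplus f)
    (hf' : Differentiable ℝ (fderiv ℝ f)) (θ v : Fin N → ℝ) :
    fderiv ℝ (fderiv ℝ f) θ v v ≤ 2 * (hessian f θ).trace * ‖v‖ ^ 2 := by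
  have hrow : ∀ i, ∑ j, |hessian f θ i j| = 2 * hessian f θ i i := fun i => by
    have h := hf.sum_hessian hf' θ i
    rw [← Finset.add_sum_erase _ _ (Finset.mem_univ i)] at h
    have hoff : ∑ j ∈ Finset.univ.erase i, |hessian f θ i j|
        = -∑ j ∈ Finset.univ.erase i, hessian f θ i j := by
      rw [← Finset.sum_neg_distrib]
      exact Finset.sum_congr rfl fun j hj =>
        abs_of_nonpos (hf.hessian_nonpos hf' θ (Finset.ne_of_mem_erase hj).symm)
    have hnonpos : ∑ j ∈ Finset.univ.erase i, hessian f θ i j ≤ 0 :=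
      Finset.sum_nonpos fun j hj => hf.hessian_nonpos hf' θ (Finset.ne_of_mem_erase hj).symm
    -- Since the row sums to zero, the off-diagonal absolute values add up to the diagonal entry.
    rw [← Finset.add_sum_erase _ _ (Finset.mem_univ i), hoff, abs_of_nonneg (by linarith)]
    linarith
  rw [fderiv_fderiv_apply_eq_sum hf']
  calc ∑ i, ∑ j, v i * (v j * hessian f θ i j)
      ≤ ∑ i, ∑ j, |hessian f θ i j| * ‖v‖ ^ 2 := by
        refine Finset.sum_le_sum fun i _ => Finset.sum_le_sum fun j _ => ?_
        refine (le_abs_self _).trans ?_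
        rw [abs_mul, abs_mul, ← mul_assoc, mul_comm, sq]
        exact mul_le_mul_of_nonneg_left (mul_le_mul (norm_le_pi_norm v i) (norm_le_pi_norm v j)
          (abs_nonneg _) (norm_nonneg _)) (abs_nonneg _)
    _ = 2 * (hessian f θ).trace * ‖v‖ ^ 2 := by
        simp only [← Finset.sum_mul, hrow, ← Finset.mul_sum, Matrix.trace, Matrix.diag_apply]

end hessian

/-! ### Fenchel duality and the leader -/

section leader

variable {N : ℕ} {f : (Fin N → ℝ) → ℝ}

theorem le_convexConjugate (f : (Fin N → ℝ) → ℝ) (θ x : Fin N → ℝ) :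
    ((θ ⬝ᵥ x - f θ : ℝ) : EReal) ≤ convexConjugate f x :=
  le_iSup (fun θ : Fin N → ℝ => ((θ ⬝ᵥ x - f θ : ℝ) : EReal)) θ

/-- The Fenchel–Young inequality. -/
theorem dotProduct_sub_convexConjugate_le (f : (Fin N → ℝ) → ℝ) (θ x : Fin N → ℝ) :
    ((θ ⬝ᵥ x : ℝ) : EReal) - convexConjugate f x ≤ (f θ : EReal) := by
  refine (EReal.sub_le_sub le_rfl (le_convexConjugate f θ x)).trans_eq ?_
  rw [← EReal.coe_sub, sub_sub_cancel]

/-- The tangent plane at `θ` lies below `f`, so the supremum is attained at `θ`. -/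
theorem convexConjugate_gradientVector (hc : ConvexOn ℝ Set.univ f) (hd : Differentiable ℝ f)
    (θ : Fin N → ℝ) : convexConjugate f (gradientVector f θ)
      = ((θ ⬝ᵥ gradientVector f θ - f θ : ℝ) : EReal) := by
  refine le_antisymm (iSup_le fun θ' => EReal.coe_le_coe_iff.2 ?_) (le_convexConjugate f θ _)
  have := add_fderiv_le_of_convexOn hc hd θ (θ' - θ)
  rw [fderiv_apply_eq_dotProduct, sub_dotProduct, add_sub_cancel] at this
  linarith

/-- Equality in the Fenchel–Young inequality at a point of differentiability forces the gradient. -/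
theorem eq_gradientVector_of_le (hd : Differentiable ℝ f) {θ x : Fin N → ℝ}
    (h : (f θ : EReal) ≤ ((θ ⬝ᵥ x : ℝ) : EReal) - convexConjugate f x) :
    x = gradientVector f θ := by
  -- Equality means that `θ` maximizes `θ' ⬝ᵥ x - f θ'`; the first-order condition then identifies
  -- `x`.
  have hsub : ∀ θ', θ' ⬝ᵥ x - f θ' ≤ θ ⬝ᵥ x - f θ := fun θ' => by
    have := h.trans (EReal.sub_le_sub le_rfl (le_convexConjugate f θ' x))
    rw [← EReal.coe_sub, EReal.coe_le_coe_iff] at this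
    linarith
  ext i
  have hg : HasDerivAt (fun s : ℝ => (θ + s • Pi.single i 1) ⬝ᵥ x - f (θ + s • Pi.single i 1))
      (x i - gradientVector f θ i) 0 := by
    have h₁ : HasDerivAt (fun s : ℝ => (θ + s • Pi.single i 1) ⬝ᵥ x) (x i) 0 := by
      simp only [add_dotProduct, smul_dotProduct, single_dotProduct, one_mul, smul_eq_mul]
      simpa using ((hasDerivAt_id (0 : ℝ)).mul_const (x i)).const_add (θ ⬝ᵥ x)
    simpa only [zero_smul, add_zero] using! h₁.sub (hasDerivAt_comp_line hd θ (Pi.single i 1) 0)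
  have hmax : IsLocalMax
      (fun s : ℝ => (θ + s • Pi.single i 1) ⬝ᵥ x - f (θ + s • Pi.single i 1)) 0 :=
    Eventually.of_forall fun s => by
      simpa only [zero_smul, add_zero] using hsub (θ + s • Pi.single i 1)
  exact sub_eq_zero.1 (hmax.hasDerivAt_eq_zero hg)

theorem isRegularizedLeader_iff [NeZero N] {F : Measure (Fin N → ℝ)} {η : ℝ}
    (hs : IsSurplus (socialSurplus F η)) (hd : Differentiable ℝ (socialSurplus F η))
    (θ x : Fin N → ℝ) :
    IsRegularizedLeader F η θ x ↔ x = gradientVector (socialSurplus F η) θ := by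
  have hval : ((θ ⬝ᵥ gradientVector (socialSurplus F η) θ : ℝ) : EReal)
      - regularizer F η (gradientVector (socialSurplus F η) θ) = (socialSurplus F η θ : ℝ) := by
    rw [regularizer, convexConjugate_gradientVector hs.convexOn hd, ← EReal.coe_sub,
      sub_sub_cancel]
  have hmem := hs.gradientVector_mem_stdSimplex hd θ
  constructor
  · exact fun h => eq_gradientVector_of_le hd (hval.symm.le.trans (h.2 hmem))
  · rintro rfl
    exact ⟨hmem, fun y _ => (dotProduct_sub_convexConjugate_le _ θ y).trans hval.symm.le⟩

end leader

/-! ### The potential argument -/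

section regret

variable {N : ℕ} {F : Measure (Fin N → ℝ)}

theorem cumulativePayoff_succ (u : ℕ → Fin N → ℝ) (t : ℕ) :
    cumulativePayoff u (t + 1) = cumulativePayoff u t + u (t + 1) :=
  Finset.sum_Icc_succ_top (Nat.le_add_left 1 t) u

theorem ShocksAssumption.sSup_dotProduct_le [NeZero N] (hF : ShocksAssumption F) (η : ℝ) (θ : Fin N → ℝ) :
    sSup ((fun y => θ ⬝ᵥ y) '' stdSimplex ℝ (Fin N)) ≤ socialSurplus F η θ := by
  refine csSup_le (Set.Nonempty.image _ ⟨_, single_mem_stdSimplex ℝ 0⟩) ?_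
  rintro _ ⟨y, hy, rfl⟩
  calc θ ⬝ᵥ y ≤ ∑ i, socialSurplus F η θ * y i := Finset.sum_le_sum fun i _ =>
        mul_le_mul_of_nonneg_right (hF.apply_le_socialSurplus η θ i) (hy.1 i)
    _ = socialSurplus F η θ := by rw [← Finset.mul_sum, hy.2, mul_one]

theorem regret_le [NeZero N] (hF : ShocksAssumption F) {η L umax : ℝ} (hη : 0 < η)
    (hH : HessianAssumption F η L) {T : ℕ} {u x : ℕ → Fin N → ℝ}
    (hu : ∀ t ∈ Finset.Icc 1 T, ‖u t‖ ≤ umax) (hx : IsFTRL F η T u x) :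
    regret T u x ≤ η * socialSurplus F 1 0 + L / (2 * η) * T * umax ^ 2 := by
  have hs := hF.isSurplus η
  have hf' := hH.differentiable_fderiv
  have hd := hs.differentiable hf'.continuous
  have hstep : ∀ t < T, socialSurplus F η (cumulativePayoff u (t + 1))
      ≤ socialSurplus F η (cumulativePayoff u t) + u (t + 1) ⬝ᵥ x (t + 1)
        + L / (2 * η) * umax ^ 2 := fun t ht => by
    have hut : ‖u (t + 1)‖ ≤ umax := hu _ (Finset.mem_Icc.2 ⟨by omega, ht⟩)
    have hC : ∀ θ, fderiv ℝ (fderiv ℝ (socialSurplus F η)) θ (u (t + 1)) (u (t + 1))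
        ≤ L / η * umax ^ 2 := fun θ =>
      (hs.fderiv_fderiv_apply_le hf' θ _).trans <|
        mul_le_mul (hH.trace_le θ) (pow_le_pow_left₀ (norm_nonneg _) hut 2) (sq_nonneg _)
          (div_pos hH.pos hη).le
    -- The linear term becomes `u (t + 1) ⬝ᵥ x (t + 1)` because `x (t + 1)` is the gradient at
    -- `θ_t`, before `u (t + 1)` is added.
    have := le_add_fderiv_add_of_second_deriv_le hd hf' (θ := cumulativePayoff u t) hC
    rw [fderiv_apply_eq_dotProduct, ← (isRegularizedLeader_iff hs hd _ _).1 (hx t ht),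
      ← cumulativePayoff_succ] at this
    refine this.trans_eq ?_
    field_simp
  have hsum : ∀ t ≤ T, socialSurplus F η (cumulativePayoff u t)
      ≤ η * socialSurplus F 1 0 + ∑ s ∈ Finset.Icc 1 t, u s ⬝ᵥ x s
        + L / (2 * η) * t * umax ^ 2 := fun t ht => by
    induction t with
    | zero => simp [cumulativePayoff, socialSurplus_zero hη.le]
    | succ t ih =>
      rw [Finset.sum_Icc_succ_top (Nat.le_add_left 1 t)]
      push_cast
      linarith [hstep t ht, ih (by omega)]
  rw [regret]
  linarith [hsum T le_rfl, hF.sSup_dotProduct_le η (cumulativePayoff u T)]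

/-- The value of the bound `η a + b / (2 η)` at its minimizer `η`. -/
theorem mul_add_div_eq_of_eq_sqrt {η a b : ℝ} (hη : 0 < η) (h : η = √(b / (2 * a)))
    (hb : 0 ≤ b) : η * a + b / (2 * η) = √(2 * a * b) := by
  have hpos : 0 < b / (2 * a) := Real.sqrt_pos.1 (h ▸ hη)
  have hsq : η ^ 2 = b / (2 * a) := by rw [h, Real.sq_sqrt hpos.le]
  -- If `a ≤ 0`, the quotient is nonpositive (division by zero gives `0`), contradicting `η > 0`.
  -- Thus `φ(0) > 0` needs no separate proof.
  have ha : 0 < a := by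
    by_contra! ha
    exact hpos.not_ge (div_nonpos_of_nonneg_of_nonpos hb (by linarith))
  have hb' : b = 2 * a * η ^ 2 := by
    rw [hsq]
    field_simp
  have h₁ : 2 * a * b = (2 * a * η) ^ 2 := by
    rw [hb']
    ring
  rw [h₁, Real.sqrt_sq (by positivity), hb']
  field_simp
  ring

end regret

end RUM

theorem mainTheorem5 {N : ℕ} [NeZero N] (F : MeasureTheory.Measure (Fin N → ℝ))
    (η L umax : ℝ) (T : ℕ) (hη : 0 < η)
    (hF : RUM.ShocksAssumption F) (hH : RUM.HessianAssumption F η L) :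
    (∀ θ : Fin N → ℝ, ∃! x : Fin N → ℝ, RUM.IsRegularizedLeader F η θ x) ∧
    ∀ u x : ℕ → Fin N → ℝ,
      (∀ t ∈ Finset.Icc 1 T, ‖u t‖ ≤ umax) →
      RUM.IsFTRL F η T u x →
      RUM.regret T u x ≤ η * RUM.socialSurplus F 1 0 + L / (2 * η) * T * umax ^ 2 ∧
      (η = √(L * T * umax ^ 2 / (2 * RUM.socialSurplus F 1 0)) →
        RUM.regret T u x ≤ umax * √(2 * RUM.socialSurplus F 1 0 * L * T)) := by
  have hs := hF.isSurplus η
  have hd := hs.differentiable hH.differentiable_fderiv.continuous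
  refine ⟨fun θ => ⟨_, (RUM.isRegularizedLeader_iff hs hd θ _).2 rfl,
    fun y hy => (RUM.isRegularizedLeader_iff hs hd θ y).1 hy⟩, fun u x hu hx => ?_⟩
  have hregret := RUM.regret_le hF hη hH hu hx
  refine ⟨hregret, fun h => hregret.trans_eq ?_⟩
  -- For `T = 0` the prescribed `η` would be `0`. With a first period, `0 ≤ umax` follows from the
  -- bound on `u 1`.
  have hT : 1 ≤ T := by
    by_contra! hT
    obtain rfl : T = 0 := by omega
    simp at h
    exact hη.ne' h
  have humax : 0 ≤ umax := (norm_nonneg _).trans (hu 1 (Finset.mem_Icc.2 ⟨le_rfl, hT⟩))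
  have hL := hH.pos
  have hopt := RUM.mul_add_div_eq_of_eq_sqrt hη h (by positivity)
  have hroot : √(2 * RUM.socialSurplus F 1 0 * (L * T * umax ^ 2))
      = umax * √(2 * RUM.socialSurplus F 1 0 * L * T) := by
    rw [show 2 * RUM.socialSurplus F 1 0 * (L * T * umax ^ 2)
      = umax ^ 2 * (2 * RUM.socialSurplus F 1 0 * L * T) by ring,
      Real.sqrt_mul (sq_nonneg _), Real.sqrt_sq humax]
  rw [← hroot, ← hopt]
  ring
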